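/- For $k \geq 1$ and a finite set $X \subseteq [0,1]^k$ with $n \geq 2$ points, a Hamiltonian cycle (tour) $H$ on $X$ is an ordering $x_1, \ldots, x_n$ of the points of $X$, traversed cyclically ($x_{n+1} := x_1$; for $n=2$ the single edge is traversed twice). Its scaled cost is $s_k(H) = \left(\sum_{i=1}^n |x_i - x_{i+1}|^k\right)^{1/k}$, where $|\cdot|$ is the Euclidean norm. Let $s_k^{\mathrm{HC}}(X)$ be the minimum of $s_k(H)$ over all Hamiltonian cycles $H$ on $X$, let $s_k^{\mathrm{HC}}(n) = \sup\{ s_k^{\mathrm{HC}}(X) : X \subseteq [0,1]^k,\ |X| = n\}$, and let $s_k^{\mathrm{HC}} = \sup_{n \geq 2} s_k^{\mathrm{HC}}(n)$. **Theorem.** As $k \to \infty$, $$ s_k^{\mathrm{HC}} \leq 2.91 \sqrt{k}\,\bigl(1 + o_k(1)\bigr), $$ that is, there is a sequence $\varepsilon_k \to 0$ such that $s_k^{\mathrm{HC}} \leq 2.91\sqrt{k}\,(1+\varepsilon_k)$ for all sufficiently large $k$; in particular the bound is uniform in the number of points $n$. -/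

import Mathlib

open Filter Asymptotics
open scoped ENNReal Topology

noncomputable section

/-- The unit cube `[0,1]^k` in Euclidean `k`-space. -/
def unitCube (k : ℕ) : Set (EuclideanSpace ℝ (Fin k)) :=
  {x | ∀ i, x i ∈ Set.Icc (0 : ℝ) 1}

/-- A Hamiltonian cycle (tour) through the finite set `X`: a listing `x_1, …, x_n` of all points of
`X`, each exactly once, traversed cyclically. For `|X| = 2` the tour goes back and forth, so that
its only edge occurs twice. -/
abbrev Tour {k : ℕ} (X : Finset (EuclideanSpace ℝ (Fin k))) : Type :=
  Fin X.card ≃ X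

instance {k : ℕ} (X : Finset (EuclideanSpace ℝ (Fin k))) : Nonempty (Tour X) :=
  ⟨X.equivFin.symm⟩

/-- The unscaled cost `S_k(H) = ∑ |x_i - x_{i+1}|^k` of a tour `H = x_1, …, x_n`, with
`x_{n+1} = x_1` (the map `finRotate n` is the cyclic shift `i ↦ i + 1`). -/
def Tour.unscaledCost {k : ℕ} {X : Finset (EuclideanSpace ℝ (Fin k))} (H : Tour X) : ℝ :=
  ∑ i, dist (H i : EuclideanSpace ℝ (Fin k)) (H (finRotate X.card i)) ^ k

/-- The scaled cost `s_k(H) = S_k(H)^(1/k)` of a tour. -/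
def Tour.scaledCost {k : ℕ} {X : Finset (EuclideanSpace ℝ (Fin k))} (H : Tour X) : ℝ :=
  H.unscaledCost ^ (1 / (k : ℝ))

/-- `s_k^HC(X)`: the minimum of the scaled cost over all Hamiltonian cycles through `X`. -/
def sHCSet {k : ℕ} (X : Finset (EuclideanSpace ℝ (Fin k))) : ℝ :=
  ⨅ H : Tour X, H.scaledCost

/-- The infimum defining `s_k^HC(X)` is a minimum. -/
theorem isLeast_sHCSet {k : ℕ} (X : Finset (EuclideanSpace ℝ (Fin k))) :
    IsLeast (Set.range fun H : Tour X => H.scaledCost) (sHCSet X) := by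
  have hfin : (Set.range fun H : Tour X => H.scaledCost).Finite := Set.finite_range _
  exact ⟨(Set.range_nonempty _).csInf_mem hfin, fun _ h => csInf_le hfin.bddBelow h⟩

/-- `s_k^HC(n)`: the supremum of `s_k^HC(X)` over all `n`-element subsets `X` of the unit cube
`[0,1]^k`. It is taken in `[0, ∞]`, so that it is infinite when there is no finite bound. -/
def sHCCard (k n : ℕ) : ℝ≥0∞ :=
  ⨆ (X : Finset (EuclideanSpace ℝ (Fin k))) (_ : (X : Set (EuclideanSpace ℝ (Fin k))) ⊆ unitCube k)
    (_ : X.card = n), ENNReal.ofReal (sHCSet X)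

/-- `s_k^HC = sup_{n ≥ 2} s_k^HC(n)`. -/
def sHC (k : ℕ) : ℝ≥0∞ :=
  ⨆ (n : ℕ) (_ : 2 ≤ n), sHCCard k n

end

/-! The tour comes from a minimal spanning tree. The cube of a tree is Hamiltonian: there is a tour
in which each step short-cuts at most three tree edges and each tree edge is charged at most twice.
A step is at most three times its longest edge, and at most the diameter √k of the cube, so the cost
is at most 2 ∑ min(3|e|, √k)^k (`exists_tour_unscaledCost_le`). This sum is split by the length of
the edges.

Short edges: minimality forces the open balls of radius |e|/4 about the edge midpoints to be
disjoint (`le_dist_center`). They stay close to the cube, so their total volume is at most 1.002^k.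
The unit ball has volume (2πe/k)^(k/2) up to a polynomial factor, hence ∑ (3|e|)^k is governed by
(12√k/√(2πe))^k, where 12/√(2πe) ≈ 2.904. This is where the constant of the theorem comes from
(`sum_short_pow_le`).

Longer edges: these are sorted into finitely many geometric scales, their number not depending on k.
Edges of length at least l yield an l-separated set with one point more (`exists_separated`), and
the balls of radius 2l/3 about such points overlap at most ninefold. By the cap √k only l ≤ √k/3
matters, and then each scale contributes at most (2.76√k)^k up to a factor linear in k
(`card_mul_pow_le_of_separated`). Linear factors disappear in the k-th root, and no estimate
involves the number of points. -/

/-! ### Trees as iterated joins, and minimal spanning trees -/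

/-- Trees on a set of points, built by joining two trees along the edge between their roots. The
root of the joined tree is the root of its first part. -/
inductive JoinTree (α : Type*) : Type _
  | leaf (a : α) : JoinTree α
  | join (s t : JoinTree α) : JoinTree α

namespace JoinTree

variable {α : Type*}

/-- The root of a tree. -/
def root : JoinTree α → α
  | leaf a => a
  | join s _ => s.root

/-- The vertices of a tree. -/
def verts : JoinTree α → Multiset α
  | leaf a => {a}
  | join s t => s.verts + t.verts

/-- The edges of a tree. -/
def edges : JoinTree α → Multiset (Sym2 α)
  | leaf _ => 0
  | join s t => s(s.root, t.root) ::ₘ (s.edges + t.edges)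

theorem root_mem_verts (t : JoinTree α) : t.root ∈ t.verts := by
  induction t with
  | leaf a => simp [root, verts]
  | join s t hs _ => simp [root, verts, hs]

theorem mem_verts_of_mem_edges (t : JoinTree α) {e : Sym2 α} (he : e ∈ t.edges) {x : α}
    (hx : x ∈ e) : x ∈ t.verts := by
  induction t with
  | leaf a => simp [edges] at he
  | join s t hs ht =>
    simp only [edges, Multiset.mem_cons, Multiset.mem_add] at he
    simp only [verts, Multiset.mem_add]
    rcases he with rfl | he | he
    · rcases Sym2.mem_iff.1 hx with rfl | rfl
      · exact Or.inl s.root_mem_verts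
      · exact Or.inr t.root_mem_verts
    · exact Or.inl (hs he)
    · exact Or.inr (ht he)

theorem card_verts (t : JoinTree α) : t.verts.card = t.edges.card + 1 := by
  induction t with
  | leaf a => simp [edges, verts]
  | join s t hs ht => simp [edges, verts, hs, ht]; ring

/-- Keeping the root fixed makes the induction work: a joining edge only sees the roots of its two
parts, so a part may be enlarged inside a join without disturbing that edge. -/
theorem exists_attach (t : JoinTree α) {y : α} (hy : y ∈ t.verts) (s : JoinTree α) :
    ∃ u : JoinTree α, u.root = t.root ∧ u.verts = t.verts + s.verts ∧
      u.edges = s(y, s.root) ::ₘ (t.edges + s.edges) := by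
  induction t with
  | leaf a =>
    obtain rfl : y = a := by simpa [verts] using hy
    exact ⟨join (leaf y) s, rfl, rfl, rfl⟩
  | join t₁ t₂ h₁ h₂ =>
    rcases Multiset.mem_add.1 hy with h | h
    · obtain ⟨u, hr, hv, he⟩ := h₁ h
      refine ⟨join u t₂, hr, ?_, ?_⟩
      · simp only [verts, hv]; abel
      · simp only [edges, he, hr, ← Multiset.singleton_add]; abel
    · obtain ⟨u, hr, hv, he⟩ := h₂ h
      refine ⟨join t₁ u, rfl, ?_, ?_⟩
      · simp only [verts, hv]; abel
      · simp only [edges, he, hr, ← Multiset.singleton_add]; abel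

/-- Reroot the part that contains `x`, then hang the other part back on at the old root of the
first. -/
theorem exists_reroot (t : JoinTree α) {x : α} (hx : x ∈ t.verts) :
    ∃ u : JoinTree α, u.root = x ∧ u.verts = t.verts ∧ u.edges = t.edges := by
  induction t with
  | leaf a =>
    obtain rfl : x = a := by simpa [verts] using hx
    exact ⟨leaf x, rfl, rfl, rfl⟩
  | join t₁ t₂ h₁ h₂ =>
    rcases Multiset.mem_add.1 hx with h | h
    · obtain ⟨u, hr, hv, he⟩ := h₁ h
      obtain ⟨w, hr', hv', he'⟩ := exists_attach u (hv ▸ t₁.root_mem_verts) t₂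
      exact ⟨w, hr'.trans hr, by rw [hv', hv, verts], by rw [he', he, edges]⟩
    · obtain ⟨u, hr, hv, he⟩ := h₂ h
      obtain ⟨w, hr', hv', he'⟩ := exists_attach u (hv ▸ t₂.root_mem_verts) t₁
      exact ⟨w, hr'.trans hr, by rw [hv', hv, verts, add_comm],
        by rw [he', he, edges, Sym2.eq_swap, add_comm]⟩

/-- Two trees can be linked along an arbitrary edge. -/
theorem exists_link (s t : JoinTree α) {a b : α} (ha : a ∈ s.verts) (hb : b ∈ t.verts) :
    ∃ u : JoinTree α, u.verts = s.verts + t.verts ∧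
      u.edges = s(a, b) ::ₘ (s.edges + t.edges) := by
  obtain ⟨t', hr, hv, he⟩ := exists_reroot t hb
  obtain ⟨u, -, hv', he'⟩ := exists_attach s ha t'
  exact ⟨u, by rw [hv', hv], by rw [he', he, hr]⟩

/-- Removing an edge splits a tree into two trees. -/
theorem exists_split (t : JoinTree α) {e : Sym2 α} (he : e ∈ t.edges) :
    ∃ (u w : JoinTree α) (a b : α), e = s(a, b) ∧ a ∈ u.verts ∧ b ∈ w.verts ∧
      t.verts = u.verts + w.verts ∧ t.edges = s(a, b) ::ₘ (u.edges + w.edges) := by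
  induction t with
  | leaf a => simp [edges] at he
  | join t₁ t₂ h₁ h₂ =>
    simp only [edges, Multiset.mem_cons, Multiset.mem_add] at he
    rcases he with rfl | he | he
    · exact ⟨t₁, t₂, _, _, rfl, t₁.root_mem_verts, t₂.root_mem_verts, rfl, rfl⟩
    · obtain ⟨u, w, a, b, rfl, ha, hb, hv, he⟩ := h₁ he
      have hr : t₁.root ∈ u.verts + w.verts := hv ▸ t₁.root_mem_verts
      rcases Multiset.mem_add.1 hr with hr | hr
      · obtain ⟨x, hxv, hxe⟩ := exists_link u t₂ hr t₂.root_mem_verts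
        refine ⟨x, w, a, b, rfl, ?_, hb, ?_, ?_⟩
        · simp [hxv, ha]
        · simp only [verts, hv, hxv]; abel
        · simp only [edges, he, hxe, ← Multiset.singleton_add]; abel
      · obtain ⟨x, hxv, hxe⟩ := exists_link w t₂ hr t₂.root_mem_verts
        refine ⟨u, x, a, b, rfl, ha, ?_, ?_, ?_⟩
        · simp [hxv, hb]
        · simp only [verts, hv, hxv]; abel
        · simp only [edges, he, hxe, ← Multiset.singleton_add]; abel
    · obtain ⟨u, w, a, b, rfl, ha, hb, hv, he⟩ := h₂ he
      have hr : t₂.root ∈ u.verts + w.verts := hv ▸ t₂.root_mem_verts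
      rcases Multiset.mem_add.1 hr with hr | hr
      · obtain ⟨x, hxv, hxe⟩ := exists_link t₁ u t₁.root_mem_verts hr
        refine ⟨x, w, a, b, rfl, ?_, hb, ?_, ?_⟩
        · simp [hxv, ha]
        · simp only [verts, hv, hxv]; abel
        · simp only [edges, he, hxe, ← Multiset.singleton_add]; abel
      · obtain ⟨x, hxv, hxe⟩ := exists_link t₁ w t₁.root_mem_verts hr
        refine ⟨u, x, a, b, rfl, ha, ?_, ?_, ?_⟩
        · simp [hxv, hb]
        · simp only [verts, hv, hxv]; abel
        · simp only [edges, he, hxe, ← Multiset.singleton_add]; abel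

theorem exists_verts_eq (X : Multiset α) (hX : X ≠ 0) : ∃ t : JoinTree α, t.verts = X := by
  induction X using Multiset.induction_on with
  | empty => exact absurd rfl hX
  | cons a X ih =>
    rcases eq_or_ne X 0 with rfl | h
    · exact ⟨leaf a, rfl⟩
    · obtain ⟨t, rfl⟩ := ih h
      exact ⟨join (leaf a) t, rfl⟩

/-- A tree of minimal total length among the trees with the same vertices. -/
def IsMinimal (len : Sym2 α → ℝ) (t : JoinTree α) : Prop :=
  ∀ u : JoinTree α, u.verts = t.verts → (t.edges.map len).sum ≤ (u.edges.map len).sum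

/-- Only finitely many edge multisets compete: all ends lie in `X`, and no multiplicity exceeds the
number of edges, which is below `X.card`. -/
theorem exists_isMinimal (len : Sym2 α → ℝ) (X : Multiset α) (hX : X ≠ 0) :
    ∃ t : JoinTree α, t.verts = X ∧ t.IsMinimal len := by
  classical
  let A : Set (Multiset (Sym2 α)) := {m | ∃ t : JoinTree α, t.verts = X ∧ t.edges = m}
  have hA : A.Finite := by
    refine (Set.finite_Iic (X.card • X.toFinset.sym2.val)).subset ?_
    rintro _ ⟨t, rfl, rfl⟩
    refine Multiset.le_iff_count.2 fun e => ?_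
    by_cases he : e ∈ t.edges
    · have h1 : e ∈ t.verts.toFinset.sym2 := by
        rw [Finset.mem_sym2_iff]
        intro x hx
        exact Multiset.mem_toFinset.2 (t.mem_verts_of_mem_edges he hx)
      have h2 : 1 ≤ t.verts.toFinset.sym2.val.count e :=
        Multiset.one_le_count_iff_mem.2 h1
      rw [Multiset.count_nsmul, t.card_verts]
      calc t.edges.count e ≤ t.edges.card := Multiset.count_le_card _ _
        _ ≤ (t.edges.card + 1) * 1 := by omega
        _ ≤ _ := Nat.mul_le_mul_left _ h2
    · simp [Multiset.count_eq_zero_of_notMem he]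
  have hne : A.Nonempty := by
    obtain ⟨t, ht⟩ := exists_verts_eq X hX
    exact ⟨_, t, ht, rfl⟩
  obtain ⟨m, ⟨t, ht, rfl⟩, hm⟩ := Set.exists_min_image A (fun m => (m.map len).sum) hA hne
  exact ⟨t, ht, fun u hu => hm _ ⟨u, hu.trans ht, rfl⟩⟩

namespace IsMinimal

variable {len : Sym2 α → ℝ} {t u w : JoinTree α} {a b : α}

/-- The exchange argument: relinking the two parts along another edge gives a competitor on the same
vertices. -/
theorem le_of_split (ht : t.IsMinimal len) (hv : t.verts = u.verts + w.verts)
    (he : t.edges = s(a, b) ::ₘ (u.edges + w.edges)) {x y : α} (hx : x ∈ u.verts)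
    (hy : y ∈ w.verts) : len s(a, b) ≤ len s(x, y) := by
  obtain ⟨z, hzv, hze⟩ := exists_link u w hx hy
  have := ht z (hzv.trans hv.symm)
  simpa [he, hze] using this

theorem left_of_split (ht : t.IsMinimal len) (hv : t.verts = u.verts + w.verts)
    (he : t.edges = s(a, b) ::ₘ (u.edges + w.edges)) (ha : a ∈ u.verts) (hb : b ∈ w.verts) :
    u.IsMinimal len := by
  intro v hvu
  obtain ⟨z, hzv, hze⟩ := exists_link v w (hvu ▸ ha) hb
  have := ht z (by rw [hzv, hvu, hv])
  simpa [he, hze] using this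

theorem right_of_split (ht : t.IsMinimal len) (hv : t.verts = u.verts + w.verts)
    (he : t.edges = s(a, b) ::ₘ (u.edges + w.edges)) (ha : a ∈ u.verts) (hb : b ∈ w.verts) :
    w.IsMinimal len :=
  ht.left_of_split (u := w) (w := u) (a := b) (b := a) (by rw [hv, add_comm])
    (by rw [he, Sym2.eq_swap, add_comm]) hb ha

end IsMinimal

end JoinTree

/-! ### Metric consequences of minimality -/

/-- The length of an unordered pair of points. -/
def Sym2.length {α : Type*} [PseudoMetricSpace α] : Sym2 α → ℝ :=
  Sym2.lift ⟨dist, dist_comm⟩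

@[simp]
theorem Sym2.length_mk {α : Type*} [PseudoMetricSpace α] (a b : α) :
    Sym2.length s(a, b) = dist a b := rfl

theorem Sym2.length_nonneg {α : Type*} [PseudoMetricSpace α] (e : Sym2 α) : 0 ≤ e.length := by
  induction e with
  | _ a b => exact dist_nonneg

/-- The midpoint of an unordered pair of points. -/
noncomputable def Sym2.center {V : Type*} [AddCommGroup V] [Module ℝ V] : Sym2 V → V :=
  Sym2.lift ⟨midpoint ℝ, midpoint_comm⟩

theorem Sym2.center_mk {V : Type*} [AddCommGroup V] [Module ℝ V] (a b : V) :
    Sym2.center s(a, b) = midpoint ℝ a b := rfl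

theorem four_mul_sq_dist_midpoint_midpoint {V : Type*} [NormedAddCommGroup V]
    [InnerProductSpace ℝ V] (a b c d : V) :
    4 * dist (midpoint ℝ a b) (midpoint ℝ c d) ^ 2 =
      dist a c ^ 2 + dist a d ^ 2 + dist b c ^ 2 + dist b d ^ 2 - dist a b ^ 2 - dist c d ^ 2 := by
  have h : midpoint ℝ a b - midpoint ℝ c d = (2⁻¹ : ℝ) • ((a - d) + (b - c)) := by
    simp only [midpoint_eq_smul_add, invOf_eq_inv]
    module
  have h1 : b - d = (b - c) + (a - d) - (a - c) := by abel
  have h2 : a - b = (a - c) - (b - c) := by abel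
  have h3 : c - d = (a - d) - (a - c) := by abel
  simp only [dist_eq_norm, h, norm_smul]
  rw [h1, h2, h3]
  generalize a - c = p
  generalize a - d = q
  generalize b - c = r
  have hn : ‖(2⁻¹ : ℝ)‖ = 2⁻¹ := by norm_num
  rw [hn, mul_pow, norm_sub_sq_real, norm_sub_sq_real, norm_sub_sq_real, norm_add_sq_real,
    norm_add_sq_real, inner_add_left, real_inner_comm r p, real_inner_comm r q]
  ring

namespace JoinTree.IsMinimal

/-- Deleting an edge of length at least `l` leaves two minimal trees which, by the exchange
argument, are at least `l` apart. Separated sets of the two parts can therefore be united, and each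
deleted edge gains one point. -/
theorem exists_separated {α : Type*} [MetricSpace α] {t : JoinTree α}
    (ht : t.IsMinimal Sym2.length) {l : ℝ} (hl : 0 < l) :
    ∃ S : Finset α, (∀ x ∈ S, x ∈ t.verts) ∧
      S.card = t.edges.countP (fun e => l ≤ e.length) + 1 ∧
      ∀ x ∈ S, ∀ y ∈ S, x ≠ y → l ≤ dist x y := by
  classical
  induction hn : t.edges.card using Nat.strong_induction_on generalizing t with
  | _ n ih =>
  by_cases h : ∃ e ∈ t.edges, l ≤ e.length
  · obtain ⟨e, he, hle⟩ := h
    obtain ⟨u, w, a, b, rfl, ha, hb, hv, hedge⟩ := t.exists_split he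
    have hc : u.edges.card + w.edges.card + 1 = n := by
      rw [← hn, hedge, Multiset.card_cons, Multiset.card_add]
    obtain ⟨S, hS, hSc, hSd⟩ := ih _ (by omega) (ht.left_of_split hv hedge ha hb) rfl
    obtain ⟨T, hT, hTc, hTd⟩ := ih _ (by omega) (ht.right_of_split hv hedge ha hb) rfl
    have hST : ∀ x ∈ S, ∀ y ∈ T, l ≤ dist x y := fun x hx y hy =>
      hle.trans (ht.le_of_split hv hedge (hS x hx) (hT y hy))
    have hdisj : Disjoint S T := by
      refine Finset.disjoint_left.2 fun x hx hx' => ?_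
      have := hST x hx x hx'
      rw [dist_self] at this
      exact absurd hl this.not_gt
    refine ⟨S ∪ T, ?_, ?_, ?_⟩
    · intro x hx
      rw [hv, Multiset.mem_add]
      exact (Finset.mem_union.1 hx).imp (hS x) (hT x)
    · rw [Finset.card_union_of_disjoint hdisj, hSc, hTc, hedge,
        Multiset.countP_cons_of_pos (p := fun e : Sym2 α => l ≤ e.length) _ hle, Multiset.countP_add]
      ring
    · intro x hx y hy hxy
      rcases Finset.mem_union.1 hx with hx | hx <;> rcases Finset.mem_union.1 hy with hy | hy
      · exact hSd x hx y hy hxy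
      · exact hST x hx y hy
      · rw [dist_comm]; exact hST y hy x hx
      · exact hTd x hx y hy hxy
  · push Not at h
    refine ⟨{t.root}, ?_, ?_, ?_⟩
    · simpa using t.root_mem_verts
    · rw [Finset.card_singleton, Multiset.countP_eq_zero.2 fun e he => (h e he).not_ge]
    · intro x hx y hy hxy
      rw [Finset.mem_singleton.1 hx, Finset.mem_singleton.1 hy] at hxy
      exact absurd rfl hxy

/-- One of the endpoints of an edge of a minimal tree is far away from any other edge. -/
theorem exists_le_dist {α : Type*} [PseudoMetricSpace α] {t : JoinTree α}
    (ht : t.IsMinimal Sym2.length) {e f : Sym2 α} {m : Multiset (Sym2 α)}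
    (h : t.edges = e ::ₘ f ::ₘ m) :
    ∃ a b : α, e = s(a, b) ∧ ∀ x ∈ f, e.length ≤ dist a x := by
  obtain ⟨u, w, a, b, rfl, ha, hb, hv, hedge⟩ := t.exists_split (e := e) (by simp [h])
  have hf : f ∈ u.edges + w.edges := by
    have : f ::ₘ m = u.edges + w.edges := by
      rw [h] at hedge
      exact (Multiset.cons_inj_right _).1 hedge
    rw [← this]
    exact Multiset.mem_cons_self _ _
  rcases Multiset.mem_add.1 hf with hf | hf
  · refine ⟨b, a, Sym2.eq_swap, fun x hx => ?_⟩
    rw [dist_comm]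
    exact ht.le_of_split hv hedge (u.mem_verts_of_mem_edges hf hx) hb
  · exact ⟨a, b, rfl, fun x hx => ht.le_of_split hv hedge ha (w.mem_verts_of_mem_edges hf hx)⟩

/-- Let e = ab be the longer edge and f = cd, with a and c the ends given by `exists_le_dist`. Then
|ac|, |ad| ≥ |e| and |bc| ≥ |f|, so the midpoint identity, with |bd|² dropped, gives a midpoint
distance of at least |e|/2 ≥ |e|/4 + |f|/4. -/
theorem le_dist_center {V : Type*} [NormedAddCommGroup V] [InnerProductSpace ℝ V]
    {t : JoinTree V} (ht : t.IsMinimal Sym2.length) {e f : Sym2 V} {m : Multiset (Sym2 V)}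
    (h : t.edges = e ::ₘ f ::ₘ m) :
    e.length / 4 + f.length / 4 ≤ dist e.center f.center := by
  wlog hef : f.length ≤ e.length generalizing e f
  · rw [add_comm, dist_comm]
    exact this (h.trans (Multiset.cons_swap _ _ _)) (le_of_not_ge hef)
  obtain ⟨a, b, rfl, hab⟩ := ht.exists_le_dist h
  obtain ⟨c, d, rfl, hcd⟩ := ht.exists_le_dist (h.trans (Multiset.cons_swap _ _ _))
  have h1 := hab c (by simp)
  have h2 := hab d (by simp)
  have h3 := hcd b (by simp)
  rw [dist_comm] at h3
  simp only [Sym2.center_mk, Sym2.length_mk] at *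
  have h4 := four_mul_sq_dist_midpoint_midpoint a b c d
  have hle : dist a b / 2 ≤ dist (midpoint ℝ a b) (midpoint ℝ c d) := by
    refine le_of_sq_le_sq ?_ dist_nonneg
    have e1 := pow_le_pow_left₀ dist_nonneg h1 2
    have e2 := pow_le_pow_left₀ dist_nonneg h2 2
    have e3 := pow_le_pow_left₀ dist_nonneg h3 2
    nlinarith [sq_nonneg (dist b d)]
  linarith

theorem pairwise_le_dist_center {V : Type*} [NormedAddCommGroup V] [InnerProductSpace ℝ V]
    {t : JoinTree V} (ht : t.IsMinimal Sym2.length) :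
    t.edges.toList.Pairwise fun e f => e.length / 4 + f.length / 4 ≤ dist e.center f.center := by
  -- The remainder `m` keeps track of multiplicities, so that two positions in the list always
  -- account for two separate members of `t.edges`.
  have key : ∀ (l : List (Sym2 V)) (m : Multiset (Sym2 V)), t.edges = l + m →
      l.Pairwise fun e f => e.length / 4 + f.length / 4 ≤ dist e.center f.center := by
    intro l
    induction l with
    | nil => intro _ _; exact List.Pairwise.nil
    | cons e l ih =>
      intro m hm
      refine List.Pairwise.cons (fun f hf => ?_) (ih (e ::ₘ m) ?_)
      · obtain ⟨l', hl'⟩ := Multiset.exists_cons_of_mem (Multiset.mem_coe.2 hf)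
        refine ht.le_dist_center (m := l' + m) ?_
        rw [hm, ← Multiset.cons_coe, hl', Multiset.cons_add, Multiset.cons_add]
      · rw [hm, ← Multiset.cons_coe, Multiset.cons_add, Multiset.add_cons]
  exact key _ 0 (by simp)

end JoinTree.IsMinimal

/-! ### From trees to tours -/

/-- The sum of `F` over the pairs of consecutive members of a list. -/
def List.chainSum {α : Type*} (F : α → α → ℝ) : List α → ℝ
  | a :: b :: l => F a b + chainSum F (b :: l)
  | _ => 0

namespace List

variable {α : Type*} (F : α → α → ℝ)

theorem chainSum_append (l m : List α) (hl : l ≠ []) (hm : m ≠ []) :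
    (l ++ m).chainSum F = l.chainSum F + F (l.getLast hl) (m.head hm) + m.chainSum F := by
  induction l with
  | nil => exact absurd rfl hl
  | cons a l ih =>
    cases l with
    | nil =>
      cases m with
      | nil => exact absurd rfl hm
      | cons b m => simp [chainSum]
    | cons b l =>
      have := ih (by simp)
      simp only [cons_append] at this
      simp only [cons_append, chainSum, this, getLast_cons_cons]
      ring

theorem chainSum_reverse (hF : ∀ a b, F a b = F b a) (l : List α) :
    l.reverse.chainSum F = l.chainSum F := by
  induction l with
  | nil => rfl
  | cons a l ih =>
    cases l with
    | nil => rfl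
    | cons b l =>
      rw [reverse_cons, chainSum_append F _ _ (by simp) (by simp), ih]
      simp [chainSum, hF a b]
      ring

theorem chainSum_eq_sum (a : α) (l : List α) :
    (a :: l).chainSum F = ∑ i : Fin l.length, F ((a :: l).get i.castSucc) ((a :: l).get i.succ) := by
  induction l generalizing a with
  | nil => simp [chainSum]
  | cons b l ih =>
    rw [chainSum, ih]
    exact (Fin.sum_univ_succ (n := l.length)
      fun i => F ((a :: b :: l).get i.castSucc) ((a :: b :: l).get i.succ)).symm

theorem sum_finRotate_eq {n : ℕ} (l : List α) (hl : l ≠ []) (hn : n = l.length) :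
    ∑ i : Fin n, F (l.get (Fin.cast hn i)) (l.get (Fin.cast hn (finRotate n i))) =
      l.chainSum F + F (l.getLast hl) (l.head hl) := by
  subst hn
  cases l with
  | nil => exact absurd rfl hl
  | cons a l =>
    rw [chainSum_eq_sum]
    refine (Fin.sum_univ_castSucc (n := l.length) _).trans ?_
    congr 1
    · refine Finset.sum_congr rfl fun i _ => ?_
      have : finRotate (l.length + 1) i.castSucc = i.succ := finRotate_of_lt i.2
      simp only [Fin.cast_eq_self]
      exact congrArg (fun j => F ((a :: l).get i.castSucc) ((a :: l).get j)) this
    · have : finRotate (l.length + 1) (Fin.last _) = 0 := finRotate_last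
      simp only [Fin.cast_eq_self]
      refine (congrArg (fun j => F ((a :: l).get (Fin.last _)) ((a :: l).get j)) this).trans ?_
      simp [List.getLast_eq_getElem]

end List

namespace JoinTree

variable {α : Type*}

/-- A Hamiltonian path in the cube of a tree that starts at the root and ends at `endpoint`. -/
def path : JoinTree α → List α
  | leaf a => [a]
  | join s t => s.path ++ t.path.reverse

/-- The last point of `path`: a neighbour of the root, if there is one. -/
def endpoint : JoinTree α → α
  | leaf a => a
  | join _ t => t.root

theorem coe_path (t : JoinTree α) : (t.path : Multiset α) = t.verts := by
  induction t with
  | leaf a => rfl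
  | join s t hs ht => rw [path, verts, ← hs, ← ht, ← Multiset.coe_add, Multiset.coe_reverse]

theorem path_ne_nil (t : JoinTree α) : t.path ≠ [] := by
  induction t with
  | leaf a => simp [path]
  | join s t hs _ => simp [path, hs]

theorem head_path (t : JoinTree α) : t.path.head t.path_ne_nil = t.root := by
  induction t with
  | leaf a => rfl
  | join s t hs _ => simp only [path, root, List.head_append_of_ne_nil s.path_ne_nil, hs]

theorem getLast_path (t : JoinTree α) : t.path.getLast t.path_ne_nil = t.endpoint := by
  cases t with
  | leaf a => rfl
  | join s t =>
    simp only [path, endpoint]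
    rw [List.getLast_append_of_ne_nil _ (by simpa using t.path_ne_nil), List.getLast_reverse,
      head_path]

theorem endpoint_mem_verts (t : JoinTree α) : t.endpoint ∈ t.verts := by
  cases t with
  | leaf a => simp [endpoint, verts]
  | join s t => simp [endpoint, verts, t.root_mem_verts]

/-- Walking along `path` costs at most twice the cost of the edges of the tree, if a step costs at
most as much as the edges of a path of length three that it short-cuts. -/
theorem chainSum_path_add_le (F : α → α → ℝ) (t : JoinTree α) (φ : Sym2 α → ℝ)
    (hF : ∀ a b, F a b = F b a) (hG : ∀ a, φ s(a, a) ≤ 0)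
    (hFφ : ∀ a ∈ t.verts, ∀ b ∈ t.verts, ∀ c ∈ t.verts, ∀ d ∈ t.verts,
      F a d ≤ φ s(a, b) + φ s(b, c) + φ s(c, d)) :
    t.path.chainSum F + φ s(t.root, t.endpoint) ≤ 2 * (t.edges.map φ).sum := by
  induction t with
  | leaf a => simpa [path, List.chainSum, root, endpoint, edges] using hG a
  | join s t hs ht =>
    have h1 := hs fun a ha b hb c hc d hd => hFφ a (by simp [verts, ha]) b (by simp [verts, hb])
      c (by simp [verts, hc]) d (by simp [verts, hd])
    have h2 := ht fun a ha b hb c hc d hd => hFφ a (by simp [verts, ha]) b (by simp [verts, hb])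
      c (by simp [verts, hc]) d (by simp [verts, hd])
    -- The new step short-cuts endpoint – root – root – endpoint. The outer two edges are paid by
    -- the reserves φ(root, endpoint) of the two parts; the joining edge is used here once and once
    -- more as the new reserve.
    have h3 := hFφ s.endpoint (by simp [verts, s.endpoint_mem_verts])
      s.root (by simp [verts, s.root_mem_verts]) t.root (by simp [verts, t.root_mem_verts])
      t.endpoint (by simp [verts, t.endpoint_mem_verts])
    have h4 : (join s t).path.chainSum F =
        s.path.chainSum F + F s.endpoint t.endpoint + t.path.chainSum F := by
      rw [path, List.chainSum_append F _ _ s.path_ne_nil (by simpa using t.path_ne_nil),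
        List.chainSum_reverse F hF, List.head_reverse, getLast_path, getLast_path]
    rw [h4]
    change _ + φ s(s.root, t.root) ≤ _
    simp only [edges, Multiset.map_cons, Multiset.sum_cons, Multiset.map_add,
      Multiset.sum_add]
    rw [Sym2.eq_swap] at h3
    linarith

end JoinTree

/-- The tour that visits the points in the order of a list. -/
theorem exists_tour_unscaledCost_eq {k : ℕ} (X : Finset (EuclideanSpace ℝ (Fin k)))
    (l : List (EuclideanSpace ℝ (Fin k))) (hl : (l : Multiset _) = X.val) (hne : l ≠ []) :
    ∃ H : Tour X, H.unscaledCost =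
      l.chainSum (fun x y => dist x y ^ k) + dist (l.getLast hne) (l.head hne) ^ k := by
  classical
  have hn : X.card = l.length := by rw [Finset.card_def, ← hl, Multiset.coe_card]
  have hnd : l.Nodup := by rw [← Multiset.coe_nodup, hl]; exact X.nodup
  have hmem : ∀ x, x ∈ l ↔ x ∈ X := fun x => by
    rw [← Multiset.mem_coe, hl, Finset.mem_val]
  let H : Tour X := (finCongr hn).trans
    ((hnd.getEquiv l).trans (Equiv.subtypeEquivRight hmem))
  refine ⟨H, ?_⟩
  rw [← List.sum_finRotate_eq (fun x y => dist x y ^ k) l hne hn]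
  rfl

/-- Points of the unit cube admit a tour of cost at most twice the sum over the edges of any
spanning tree of `min (3 |e|) √k ^ k`. -/
theorem exists_tour_unscaledCost_le {k : ℕ} (hk : k ≠ 0) (X : Finset (EuclideanSpace ℝ (Fin k)))
    (hX : (X : Set (EuclideanSpace ℝ (Fin k))) ⊆ unitCube k)
    (t : JoinTree (EuclideanSpace ℝ (Fin k))) (ht : t.verts = X.val)
    (φ : Sym2 (EuclideanSpace ℝ (Fin k)) → ℝ)
    (hφ : ∀ x y, φ s(x, y) = min (3 * dist x y) √k ^ k) :
    ∃ H : Tour X, H.unscaledCost ≤ 2 * (t.edges.map φ).sum := by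
  have hdiam : ∀ x ∈ t.verts, ∀ y ∈ t.verts, dist x y ≤ √k := by
    intro x hx y hy
    rw [ht] at hx hy
    have hx' := hX hx
    have hy' := hX hy
    rw [EuclideanSpace.dist_eq]
    refine Real.sqrt_le_sqrt ?_
    calc ∑ i, dist (x i) (y i) ^ 2 ≤ ∑ i : Fin k, (1 : ℝ) := by
          refine Finset.sum_le_sum fun i _ => ?_
          have h := Real.dist_le_of_mem_Icc_01 (hx' i) (hy' i)
          have := pow_le_pow_left₀ dist_nonneg h 2
          simpa using this
      _ = k := by simp
  have hφ0 : ∀ x y, 0 ≤ φ s(x, y) := fun x y => by rw [hφ]; positivity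
  have hstep : ∀ a ∈ t.verts, ∀ d ∈ t.verts, ∀ x y, dist a d ≤ 3 * dist x y →
      dist a d ^ k ≤ φ s(x, y) := by
    intro a ha d hd x y h
    rw [hφ]
    exact pow_le_pow_left₀ dist_nonneg (le_min h (hdiam a ha d hd)) k
  obtain ⟨H, hH⟩ := exists_tour_unscaledCost_eq X t.path (t.coe_path.trans ht) t.path_ne_nil
  refine ⟨H, hH.le.trans ?_⟩
  refine le_trans ?_ (t.chainSum_path_add_le (fun x y => dist x y ^ k) φ
    (fun a b => by rw [dist_comm]) (fun a => by simp [hφ, hk]) ?_)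
  · rw [t.getLast_path, t.head_path, dist_comm]
    gcongr
    exact hstep _ t.root_mem_verts _ t.endpoint_mem_verts _ _
      (by linarith [dist_nonneg (x := t.root) (y := t.endpoint)])
  · intro a ha b hb c hc d hd
    have h := dist_triangle4 a b c d
    have h1 := hφ0 a b
    have h2 := hφ0 b c
    have h3 := hφ0 c d
    -- The longest of the three edges pays alone, since |ad| is at most three times its length.
    rcases le_total (dist a b) (dist b c) with hab | hab <;>
      rcases le_total (dist b c) (dist c d) with hbc | hbc <;>
      rcases le_total (dist a b) (dist c d) with hac | hac <;>
      first
      | linarith [hstep a ha d hd a b (by linarith)]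
      | linarith [hstep a ha d hd b c (by linarith)]
      | linarith [hstep a ha d hd c d (by linarith)]

/-! ### Volume near the cube, by Gaussian weights -/

/-- A weight on the line that is `1` on the unit interval and decays like a Gaussian outside. -/
noncomputable def intervalGaussian (t x : ℝ) : ℝ :=
  (Set.Icc (0 : ℝ) 1).indicator (fun _ => 1) x +
    (Set.Ioi (0 : ℝ)).indicator (fun y => Real.exp (-t * y ^ 2)) (-x) +
    (Set.Ioi (0 : ℝ)).indicator (fun y => Real.exp (-t * y ^ 2)) (x - 1)

/-- The weight depends only on the distance from `x` to the interval, and that distance is at most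
|x - c|. -/
theorem exp_le_intervalGaussian {t c : ℝ} (ht : 0 ≤ t) (hc : c ∈ Set.Icc (0 : ℝ) 1) (x : ℝ) :
    Real.exp (-t * (x - c) ^ 2) ≤ intervalGaussian t x := by
  obtain ⟨h0, h1⟩ := hc
  unfold intervalGaussian
  rcases lt_or_ge x 0 with hx | hx
  · rw [Set.indicator_of_notMem (by simp [hx]), Set.indicator_of_mem (by simpa using hx),
      Set.indicator_of_notMem (by simp; linarith), zero_add, add_zero]
    refine Real.exp_le_exp.2 ?_
    have : (-x) ^ 2 ≤ (x - c) ^ 2 := by nlinarith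
    nlinarith
  · rcases le_or_gt x 1 with hx' | hx'
    · rw [Set.indicator_of_mem (Set.mem_Icc.2 ⟨hx, hx'⟩),
        Set.indicator_of_notMem (by simpa using hx), Set.indicator_of_notMem (by simpa using hx')]
      simp only [add_zero]
      refine Real.exp_le_one_iff.2 ?_
      nlinarith [sq_nonneg (x - c)]
    · rw [Set.indicator_of_notMem (by simp [hx']), Set.indicator_of_notMem (by simpa using hx),
        Set.indicator_of_mem (by simpa using hx'), zero_add, zero_add]
      refine Real.exp_le_exp.2 ?_
      have : (x - 1) ^ 2 ≤ (x - c) ^ 2 := by nlinarith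
      nlinarith

theorem integrable_indicator_gaussian {t : ℝ} (ht : 0 < t) :
    MeasureTheory.Integrable
      ((Set.Ioi (0 : ℝ)).indicator fun y => Real.exp (-t * y ^ 2)) :=
  (integrable_exp_neg_mul_sq ht).indicator measurableSet_Ioi

theorem integrable_indicator_Icc :
    MeasureTheory.Integrable ((Set.Icc (0 : ℝ) 1).indicator fun _ => (1 : ℝ)) :=
  (MeasureTheory.integrable_indicator_iff measurableSet_Icc).2
    (MeasureTheory.integrableOn_const (by simp))

theorem integrable_intervalGaussian {t : ℝ} (ht : 0 < t) :
    MeasureTheory.Integrable (intervalGaussian t) :=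
  (integrable_indicator_Icc.add (integrable_indicator_gaussian ht).comp_neg).add
    ((integrable_indicator_gaussian ht).comp_sub_right 1)

theorem integral_intervalGaussian {t : ℝ} (ht : 0 < t) :
    ∫ x, intervalGaussian t x = 1 + √(Real.pi / t) := by
  have h := integrable_indicator_gaussian ht
  have h1 : ∫ x, (Set.Ioi (0 : ℝ)).indicator (fun y => Real.exp (-t * y ^ 2)) x =
      √(Real.pi / t) / 2 := by
    rw [MeasureTheory.integral_indicator measurableSet_Ioi, integral_gaussian_Ioi]
  unfold intervalGaussian
  rw [MeasureTheory.integral_add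
      (f := fun x => (Set.Icc (0 : ℝ) 1).indicator (fun _ => (1 : ℝ)) x +
        (Set.Ioi (0 : ℝ)).indicator (fun y => Real.exp (-t * y ^ 2)) (-x))
      (integrable_indicator_Icc.add h.comp_neg) (h.comp_sub_right 1),
    MeasureTheory.integral_add integrable_indicator_Icc h.comp_neg,
    MeasureTheory.integral_neg_eq_self
      ((Set.Ioi (0 : ℝ)).indicator fun y => Real.exp (-t * y ^ 2)) MeasureTheory.volume,
    MeasureTheory.integral_sub_right_eq_self
      ((Set.Ioi (0 : ℝ)).indicator fun y => Real.exp (-t * y ^ 2)) 1, h1,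
    MeasureTheory.integral_indicator measurableSet_Icc]
  simp
  ring

theorem integrable_prod_intervalGaussian {t : ℝ} (ht : 0 < t) (k : ℕ) :
    MeasureTheory.Integrable
      fun y : EuclideanSpace ℝ (Fin k) => ∏ i, intervalGaussian t (y i) :=
  (PiLp.volume_preserving_ofLp (Fin k)).integrable_comp_of_integrable
    (MeasureTheory.Integrable.fintype_prod fun _ => integrable_intervalGaussian ht)

theorem integral_prod_intervalGaussian {t : ℝ} (ht : 0 < t) (k : ℕ) :
    ∫ y : EuclideanSpace ℝ (Fin k), ∏ i, intervalGaussian t (y i) = (1 + √(Real.pi / t)) ^ k := by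
  have h := (PiLp.volume_preserving_ofLp (Fin k)).integral_comp
    (MeasurableEquiv.toLp 2 (Fin k → ℝ)).symm.measurableEmbedding
    (fun y : Fin k → ℝ => ∏ i, intervalGaussian t (y i))
  rw [h, MeasureTheory.integral_fintype_prod_volume_eq_pow (fun x => intervalGaussian t x),
    integral_intervalGaussian ht, Fintype.card_fin]

/-- Volume bound for balls with centers in the unit cube that cover every point at most `M`
times. -/
theorem sum_pow_mul_volume_ball_le {k : ℕ} [NeZero k] {ι : Type*} [Fintype ι]
    (c : ι → EuclideanSpace ℝ (Fin k)) (ρ : ι → ℝ) (M : ℕ) {t R : ℝ} (ht : 0 < t)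
    (hc : ∀ i, c i ∈ unitCube k) (hρ : ∀ i, 0 ≤ ρ i) (hR : ∀ i, ρ i ≤ R)
    (hM : ∀ (y : EuclideanSpace ℝ (Fin k)) (s : Finset ι),
      (∀ i ∈ s, dist y (c i) < ρ i) → s.card ≤ M) :
    (∑ i, ρ i ^ k) * MeasureTheory.volume.real (Metric.ball (0 : EuclideanSpace ℝ (Fin k)) 1) ≤
      M * (Real.exp (t * R ^ 2) * (1 + √(Real.pi / t)) ^ k) := by
  classical
  have hint : ∀ i, MeasureTheory.Integrable
      ((Metric.ball (c i) (ρ i)).indicator fun _ => (1 : ℝ)) := fun i =>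
    (MeasureTheory.integrable_indicator_iff measurableSet_ball).2
      (MeasureTheory.integrableOn_const MeasureTheory.measure_ball_lt_top.ne)
  have hvol : ∀ i, ∫ y, (Metric.ball (c i) (ρ i)).indicator (fun _ => (1 : ℝ)) y =
      ρ i ^ k * MeasureTheory.volume.real (Metric.ball (0 : EuclideanSpace ℝ (Fin k)) 1) := by
    intro i
    rw [MeasureTheory.integral_indicator measurableSet_ball, MeasureTheory.setIntegral_const,
      smul_eq_mul, mul_one, MeasureTheory.measureReal_def,
      MeasureTheory.Measure.addHaar_ball _ _ (hρ i), ENNReal.toReal_mul,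
      ENNReal.toReal_ofReal (pow_nonneg (hρ i) _), finrank_euclideanSpace_fin,
      MeasureTheory.measureReal_def]
  calc _ = ∫ y, ∑ i, (Metric.ball (c i) (ρ i)).indicator (fun _ => (1 : ℝ)) y := by
        rw [MeasureTheory.integral_finsetSum _ fun i _ => hint i, Finset.sum_mul]
        exact Finset.sum_congr rfl fun i _ => (hvol i).symm
    _ ≤ ∫ y : EuclideanSpace ℝ (Fin k),
          M * (Real.exp (t * R ^ 2) * ∏ i, intervalGaussian t (y i)) := by
        refine MeasureTheory.integral_mono
          (MeasureTheory.integrable_finsetSum _ fun i _ => hint i)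
          (((integrable_prod_intervalGaussian ht k).const_mul _).const_mul _) fun y => ?_
        have hprod : 0 ≤ ∏ i, intervalGaussian t (y i) := Finset.prod_nonneg fun i _ =>
          (Real.exp_pos _).le.trans
            (exp_le_intervalGaussian ht.le (c := 0) (by simp) (y i))
        simp only [Set.indicator_apply, Metric.mem_ball, Finset.sum_boole]
        rcases (Finset.univ.filter fun i => dist y (c i) < ρ i).eq_empty_or_nonempty with h | h
        · rw [h]
          simp only [Finset.card_empty, Nat.cast_zero]
          positivity
        · obtain ⟨i, hi⟩ := h
          have hi' : dist y (c i) < ρ i := by simpa using hi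
          -- Within distance `R` of a center the scaled weight is at least 1, so `M` times it
          -- dominates the number of balls covering `y`.
          have hone : 1 ≤ Real.exp (t * R ^ 2) * ∏ j, intervalGaussian t (y j) := by
            calc (1 : ℝ) ≤ Real.exp (t * R ^ 2) * Real.exp (-t * dist y (c i) ^ 2) := by
                  rw [← Real.exp_add]
                  refine Real.one_le_exp ?_
                  have : dist y (c i) ^ 2 ≤ R ^ 2 :=
                    pow_le_pow_left₀ dist_nonneg (hi'.le.trans (hR i)) 2
                  nlinarith
              _ = Real.exp (t * R ^ 2) * ∏ j, Real.exp (-t * (y j - c i j) ^ 2) := by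
                  rw [← Real.exp_sum, EuclideanSpace.dist_eq, Real.sq_sqrt (by positivity),
                    Finset.mul_sum]
                  simp only [Real.dist_eq, sq_abs]
              _ ≤ _ := by
                  gcongr with j
                  exact exp_le_intervalGaussian ht.le (hc i j) (y j)
          have hcard : ((Finset.univ.filter fun i => dist y (c i) < ρ i).card : ℝ) ≤ M := by
            exact_mod_cast hM y _ fun i hi => by simpa using hi
          calc _ ≤ (M : ℝ) * 1 := by rw [mul_one]; exact hcard
            _ ≤ _ := by gcongr
    _ = _ := by
        rw [MeasureTheory.integral_const_mul, MeasureTheory.integral_const_mul,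
          integral_prod_intervalGaussian ht]

/-! ### Overlap of balls about separated points -/

/-- Points at mutual distance at least `l` have at most nine members in a ball of
radius `2 l / 3`. -/
theorem card_le_nine_of_separated {V : Type*} [NormedAddCommGroup V] [InnerProductSpace ℝ V]
    {ι : Type*} (s : Finset ι) (c : ι → V) (y : V) {l : ℝ} (hl : 0 < l)
    (hsep : ∀ i ∈ s, ∀ j ∈ s, i ≠ j → l ≤ dist (c i) (c j))
    (hy : ∀ i ∈ s, dist y (c i) < 2 / 3 * l) : s.card ≤ 9 := by
  classical
  have h1 : ∑ i ∈ s, ∑ j ∈ s, dist (c i) (c j) ^ 2 ≤ 2 * s.card * ∑ i ∈ s, dist y (c i) ^ 2 := by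
    have h : ∑ i ∈ s, ∑ j ∈ s, dist (c i) (c j) ^ 2 =
        2 * s.card * ∑ i ∈ s, ‖c i - y‖ ^ 2 - 2 * ‖∑ i ∈ s, (c i - y)‖ ^ 2 := by
      have : ∀ i j, dist (c i) (c j) ^ 2 =
          ‖c i - y‖ ^ 2 + ‖c j - y‖ ^ 2 - 2 * inner ℝ (c i - y) (c j - y) := by
        intro i j
        rw [dist_eq_norm, ← sub_sub_sub_cancel_right (c i) (c j) y, norm_sub_sq_real]
        ring
      rw [← real_inner_self_eq_norm_sq (∑ i ∈ s, (c i - y)), sum_inner]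
      simp only [inner_sum, this]
      simp only [Finset.sum_add_distrib, Finset.sum_sub_distrib, ← Finset.mul_sum,
        Finset.sum_const, nsmul_eq_mul]
      ring
    rw [h]
    simp only [dist_comm y, dist_eq_norm]
    nlinarith [sq_nonneg ‖∑ i ∈ s, (c i - y)‖]
  have h2 : (s.card : ℝ) * (s.card - 1) * l ^ 2 ≤ ∑ i ∈ s, ∑ j ∈ s, dist (c i) (c j) ^ 2 := by
    calc (s.card : ℝ) * (s.card - 1) * l ^ 2 = ∑ i ∈ s, ((s.card : ℝ) - 1) * l ^ 2 := by
          rw [Finset.sum_const, nsmul_eq_mul]; ring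
      _ ≤ _ := by
          refine Finset.sum_le_sum fun i hi => ?_
          rw [← Finset.add_sum_erase s _ hi]
          calc ((s.card : ℝ) - 1) * l ^ 2 = ∑ j ∈ s.erase i, l ^ 2 := by
                rw [Finset.sum_const, nsmul_eq_mul, Finset.cast_card_erase_of_mem hi]
            _ ≤ ∑ j ∈ s.erase i, dist (c i) (c j) ^ 2 := by
                refine Finset.sum_le_sum fun j hj => ?_
                rw [Finset.mem_erase] at hj
                exact pow_le_pow_left₀ hl.le (hsep i hi j hj.2 hj.1.symm) 2
            _ ≤ _ := by rw [dist_self]; simp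
  have h3 : ∑ i ∈ s, dist y (c i) ^ 2 ≤ s.card * (4 / 9 * l ^ 2) := by
    rw [← nsmul_eq_mul, ← Finset.sum_const]
    refine Finset.sum_le_sum fun i hi => ?_
    have := pow_le_pow_left₀ dist_nonneg (hy i hi).le 2
    linarith
  by_contra! hcard
  have hcard' : (10 : ℝ) ≤ s.card := by exact_mod_cast hcard
  have hl2 : 0 < l ^ 2 := by positivity
  -- After cancellation this reads n - 1 ≤ 8n/9. A bound on n results because 2/3 is less than 1/√2.
  have h4 : (s.card : ℝ) * (s.card - 1) * l ^ 2 ≤ 2 * s.card * (s.card * (4 / 9 * l ^ 2)) :=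
    h2.trans (h1.trans (by gcongr))
  have h5 : (s.card : ℝ) * l ^ 2 * ((s.card : ℝ) - 9) ≤ 0 := by nlinarith
  have h6 : 0 < (s.card : ℝ) * l ^ 2 * ((s.card : ℝ) - 9) :=
    mul_pos (by positivity) (by linarith)
  linarith

/-! ### Volume of the unit ball -/

/-- The step rests on (1 + 1/x)^(x+1) ≥ e, which gives x (x/e)^x ≤ ((x+1)/e)^(x+1). The spare linear
factor, weaker than Stirling's √x, is harmless after taking k-th roots. -/
theorem gamma_le_of_gamma_le {C x : ℝ} (hx : 0 < x)
    (h : Real.Gamma (x + 1) ≤ C * x * Real.exp (x * (Real.log x - 1))) (hC : 0 ≤ C) :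
    Real.Gamma (x + 1 + 1) ≤ C * (x + 1) * Real.exp ((x + 1) * (Real.log (x + 1) - 1)) := by
  have hlog : 1 ≤ (x + 1) * (Real.log (x + 1) - Real.log x) := by
    have h1 := Real.one_sub_inv_le_log_of_pos (x := (x + 1) / x) (by positivity)
    rw [Real.log_div (by positivity) hx.ne'] at h1
    calc (1 : ℝ) = (x + 1) * (1 - ((x + 1) / x)⁻¹) := by field_simp; ring
      _ ≤ _ := by gcongr
  have hexp : x * Real.exp (x * (Real.log x - 1)) ≤
      Real.exp ((x + 1) * (Real.log (x + 1) - 1)) := by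
    nth_rewrite 1 [← Real.exp_log hx]
    rw [← Real.exp_add]
    refine Real.exp_le_exp.2 ?_
    linarith
  rw [Real.Gamma_add_one (by positivity)]
  calc (x + 1) * Real.Gamma (x + 1) ≤ (x + 1) * (C * x * Real.exp (x * (Real.log x - 1))) := by
        gcongr
    _ = C * (x + 1) * (x * Real.exp (x * (Real.log x - 1))) := by ring
    _ ≤ _ := by gcongr

/-- An upper bound of Stirling type for the Gamma function at half-integers. -/
theorem exists_gamma_half_le :
    ∃ C : ℝ, 0 < C ∧ ∀ n : ℕ, n ≠ 0 → Real.Gamma ((n : ℝ) / 2 + 1) ≤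
      C * ((n : ℝ) / 2) * Real.exp ((n : ℝ) / 2 * (Real.log ((n : ℝ) / 2) - 1)) := by
  let r : ℝ → ℝ := fun x => x * Real.exp (x * (Real.log x - 1))
  have hr : ∀ x, 0 < x → 0 < r x := fun x hx => by positivity
  let C := max (Real.Gamma (1 / 2 + 1) / r (1 / 2)) (Real.Gamma (1 + 1) / r 1)
  have hC : 0 < C := lt_max_of_lt_right (div_pos (Real.Gamma_pos_of_pos (by norm_num))
    (hr 1 one_pos))
  -- Raising the argument by 1 raises `n` by 2, so two consecutive cases are carried along.
  have key : ∀ n : ℕ,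
      (Real.Gamma (((n : ℝ) + 1) / 2 + 1) ≤ C * (((n : ℝ) + 1) / 2) *
        Real.exp (((n : ℝ) + 1) / 2 * (Real.log (((n : ℝ) + 1) / 2) - 1))) ∧
      (Real.Gamma (((n : ℝ) + 2) / 2 + 1) ≤ C * (((n : ℝ) + 2) / 2) *
        Real.exp (((n : ℝ) + 2) / 2 * (Real.log (((n : ℝ) + 2) / 2) - 1))) := by
    intro n
    induction n with
    | zero =>
      have h1 : Real.Gamma (1 / 2 + 1) ≤ C * r (1 / 2) :=
        (div_le_iff₀ (hr _ (by norm_num))).1 (le_max_left _ _)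
      have h2 : Real.Gamma (1 + 1) ≤ C * r 1 :=
        (div_le_iff₀ (hr _ (by norm_num))).1 (le_max_right _ _)
      refine ⟨?_, ?_⟩
      · simpa only [Nat.cast_zero, zero_add, mul_assoc] using h1
      · have : ((0 : ℕ) + 2 : ℝ) / 2 = 1 := by norm_num
        rw [this, mul_assoc]
        exact h2
    | succ n ih =>
      have h := gamma_le_of_gamma_le (by positivity) ih.1 hC.le
      have e1 : ((n : ℝ) + 1) / 2 + 1 = ((n + 1 : ℕ) + 2 : ℝ) / 2 := by push_cast; ring
      have e2 : ((n : ℝ) + 2) = ((n + 1 : ℕ) + 1 : ℝ) := by push_cast; ring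
      rw [e1] at h
      rw [← e2]
      exact ⟨ih.2, h⟩
  refine ⟨C, hC, fun n hn => ?_⟩
  obtain ⟨m, rfl⟩ := Nat.exists_eq_succ_of_ne_zero hn
  simpa using (key m).1

/-- The unit ball has volume at least `(√(2πe/k))^k`, up to a factor linear in `k`. -/
theorem exists_one_le_mul_volume_ball :
    ∃ C : ℝ, 0 < C ∧ ∀ k : ℕ, k ≠ 0 → 1 ≤ C * k * (√k / 4.1324) ^ k *
      MeasureTheory.volume.real (Metric.ball (0 : EuclideanSpace ℝ (Fin k)) 1) := by
  obtain ⟨C, hC, h⟩ := exists_gamma_half_le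
  refine ⟨C, hC, fun k hk => ?_⟩
  have : NeZero k := ⟨hk⟩
  have hk' : (0 : ℝ) < k := by exact_mod_cast Nat.pos_of_ne_zero hk
  have hG : 0 < Real.Gamma ((k : ℝ) / 2 + 1) := Real.Gamma_pos_of_pos (by positivity)
  have hvol : MeasureTheory.volume.real (Metric.ball (0 : EuclideanSpace ℝ (Fin k)) 1) =
      √Real.pi ^ k / Real.Gamma ((k : ℝ) / 2 + 1) := by
    rw [MeasureTheory.measureReal_def, EuclideanSpace.volume_ball]
    simp only [ENNReal.ofReal_one, one_pow, one_mul, Fintype.card_fin]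
    exact ENNReal.toReal_ofReal (by positivity)
  have hexp : Real.exp ((k : ℝ) / 2 * (Real.log ((k : ℝ) / 2) - 1)) =
      √((k : ℝ) / (2 * Real.exp 1)) ^ k := by
    have h1 : √((k : ℝ) / (2 * Real.exp 1)) = Real.exp ((Real.log ((k : ℝ) / 2) - 1) / 2) := by
      rw [Real.exp_half, Real.exp_sub, Real.exp_log (by positivity), div_div]
    rw [h1, ← Real.exp_nat_mul]
    congr 1
    ring
  rw [hvol, mul_div_assoc', le_div_iff₀ hG, one_mul]
  refine (h k hk).trans ?_
  rw [hexp, mul_assoc (C * (k : ℝ)), ← mul_pow]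
  -- 4.1324 lies just below √(2πe) ≈ 4.1327.
  have hconst : (4.1324 : ℝ) ^ 2 ≤ 2 * Real.pi * Real.exp 1 := by
    nlinarith [Real.pi_gt_d4, Real.exp_one_gt_d9]
  have hle : √((k : ℝ) / (2 * Real.exp 1)) ≤ √k / 4.1324 * √Real.pi := by
    refine Real.sqrt_le_iff.2 ⟨by positivity, ?_⟩
    rw [mul_pow, div_pow, Real.sq_sqrt hk'.le, Real.sq_sqrt Real.pi_pos.le,
      div_le_iff₀ (by positivity)]
    calc (k : ℝ) = k / 4.1324 ^ 2 * 4.1324 ^ 2 := by norm_num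
      _ ≤ k / 4.1324 ^ 2 * (2 * Real.pi * Real.exp 1) := by gcongr
      _ = _ := by ring
  gcongr
  linarith

/-! ### Contributions of long and short edges -/

theorem midpoint_mem_unitCube {k : ℕ} {a b : EuclideanSpace ℝ (Fin k)} (ha : a ∈ unitCube k)
    (hb : b ∈ unitCube k) : midpoint ℝ a b ∈ unitCube k := by
  intro i
  have : midpoint ℝ a b i = (a i + b i) / 2 := by
    simp [midpoint_eq_smul_add]
    ring
  obtain ⟨h1, h2⟩ := ha i
  obtain ⟨h3, h4⟩ := hb i
  rw [this]
  constructor <;> linarith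

/-- Upper bound for the number of points of the unit cube at mutual distance at least `x √k`. -/
theorem card_mul_pow_le_of_separated {C : ℝ} {k : ℕ} [NeZero k] (hC : 0 < C)
    (hball : 1 ≤ C * k * (√k / 4.1324) ^ k *
      MeasureTheory.volume.real (Metric.ball (0 : EuclideanSpace ℝ (Fin k)) 1))
    (S : Finset (EuclideanSpace ℝ (Fin k))) (hS : ∀ x ∈ S, x ∈ unitCube k) {x : ℝ} (hx : 0 < x)
    (hx3 : x ≤ 1 / 3) (hsep : ∀ a ∈ S, ∀ b ∈ S, a ≠ b → x * √k ≤ dist a b) :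
    S.card * (3.3 * (x * √k)) ^ k ≤ 9 * (C * k * (2.76 * √k) ^ k) := by
  have hk : (0 : ℝ) < k := by exact_mod_cast NeZero.pos k
  have hsk : 0 < √(k : ℝ) := Real.sqrt_pos.2 hk
  have hl : 0 < x * √(k : ℝ) := mul_pos hx hsk
  have hcard : ∀ (y : EuclideanSpace ℝ (Fin k)) (s : Finset S),
      (∀ i ∈ s, dist y (i : EuclideanSpace ℝ (Fin k)) < 2 / 3 * (x * √k)) → s.card ≤ 9 :=
    fun y s hs => card_le_nine_of_separated s (fun i : S => (i : EuclideanSpace ℝ (Fin k))) y hl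
      (fun i _ j _ hij => hsep i i.2 j j.2 fun h => hij (Subtype.ext h)) hs
  have hρ : 0 ≤ 2 / 3 * (x * √(k : ℝ)) := by positivity
  -- Here R ≤ 2√k/9, so `t = 4` gives the base e^(16/81) (1 + √(π/4)) < 2.3. Disjoint balls of
  -- radius l/2 would not bring this estimate below 2.91.
  have h := sum_pow_mul_volume_ball_le (fun i : S => (i : EuclideanSpace ℝ (Fin k)))
    (fun _ => 2 / 3 * (x * √k)) 9 (t := 4) (R := 2 / 3 * (x * √k)) four_pos (fun i => hS i i.2)
    (fun _ => hρ) (fun _ => le_rfl) hcard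
  rw [Finset.sum_const, Finset.card_univ, Fintype.card_coe, nsmul_eq_mul] at h
  generalize MeasureTheory.volume.real (Metric.ball (0 : EuclideanSpace ℝ (Fin k)) 1) = ω at *
  have hexp : Real.exp (4 * (2 / 3 * (x * √k)) ^ 2) ≤ (1.219 : ℝ) ^ k := by
    have h1 : 4 * (2 / 3 * (x * √k)) ^ 2 ≤ k * (16 / 81) := by
      rw [mul_pow, mul_pow, Real.sq_sqrt hk.le]
      have : x ^ 2 ≤ (1 / 3) ^ 2 := pow_le_pow_left₀ hx.le hx3 2
      nlinarith
    have h2 : Real.exp (16 / 81) ≤ 1.219 := by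
      have := Real.exp_bound' (x := 16 / 81) (by norm_num) (by norm_num) (n := 4) (by norm_num)
      refine this.trans ?_
      norm_num [Finset.sum_range_succ, Nat.factorial]
    calc _ ≤ Real.exp (k * (16 / 81)) := Real.exp_le_exp.2 h1
      _ = Real.exp (16 / 81) ^ k := Real.exp_nat_mul _ _
      _ ≤ _ := by gcongr
  have hsqrt : 1 + √(Real.pi / 4) ≤ 1.8863 := by
    have : √(Real.pi / 4) ≤ 0.8863 := by
      rw [Real.sqrt_le_iff]
      constructor
      · norm_num
      · linarith [Real.pi_lt_d4]
    linarith
  have h' : S.card * (2 / 3 * (x * √k)) ^ k * ω ≤ 9 * 2.3 ^ k := by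
    calc _ ≤ _ := h
      _ ≤ ((9 : ℕ) : ℝ) * (1.219 ^ k * 1.8863 ^ k) := by gcongr
      _ ≤ 9 * 2.3 ^ k := by
        rw [← mul_pow]
        push_cast
        gcongr
        norm_num
  calc S.card * (3.3 * (x * √k)) ^ k
      ≤ S.card * (3.3 * (x * √k)) ^ k * (C * k * (√k / 4.1324) ^ k * ω) :=
        le_mul_of_one_le_right (by positivity) hball
    _ = (S.card * (2 / 3 * (x * √k)) ^ k * ω) * (C * k * (4.95 * (√k / 4.1324)) ^ k) := by
        -- The final base is 2.3 · 4.95 / 4.1324 < 2.76.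
        have : 3.3 * (x * √k) = 4.95 * (2 / 3 * (x * √k)) := by ring
        rw [this, mul_pow 4.95, mul_pow 4.95]
        ring
    _ ≤ 9 * 2.3 ^ k * (C * k * (4.95 * (√k / 4.1324)) ^ k) := by gcongr
    _ = 9 * (C * k * (2.3 * (4.95 * (√k / 4.1324))) ^ k) := by
        rw [mul_pow 2.3]
        ring
    _ ≤ _ := by
        have : 2.3 * (4.95 * (√(k : ℝ) / 4.1324)) = 2.3 * 4.95 / 4.1324 * √k := by ring
        rw [this]
        gcongr
        norm_num

/-- The contribution of the short edges of a minimal spanning tree. -/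
theorem sum_short_pow_le {C : ℝ} {k : ℕ} [NeZero k] (hC : 0 < C)
    (hball : 1 ≤ C * k * (√k / 4.1324) ^ k *
      MeasureTheory.volume.real (Metric.ball (0 : EuclideanSpace ℝ (Fin k)) 1))
    {t : JoinTree (EuclideanSpace ℝ (Fin k))} (ht : t.IsMinimal Sym2.length)
    (hcube : ∀ x ∈ t.verts, x ∈ unitCube k) (l : List (Sym2 (EuclideanSpace ℝ (Fin k))))
    (hl : l.Sublist t.edges.toList) (hshort : ∀ e ∈ l, e.length ≤ 1 / 20000 * √k) :
    (l.map fun e => (3 * e.length) ^ k).sum ≤ C * k * (2.9098 * √k) ^ k := by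
  have hk : (0 : ℝ) < k := by exact_mod_cast NeZero.pos k
  have hpair := ht.pairwise_le_dist_center.sublist hl
  have hdisj : ∀ i j : Fin l.length, i ≠ j → (l.get i).length / 4 + (l.get j).length / 4 ≤
      dist (l.get i).center (l.get j).center := by
    intro i j hij
    rcases lt_or_gt_of_ne hij with h | h
    · exact List.pairwise_iff_get.1 hpair i j h
    · rw [add_comm, dist_comm]
      exact List.pairwise_iff_get.1 hpair j i h
  -- This `t` makes √(π/t) equal to 1/1000, while the tiny radii keep tR² below 0.0005 k. Both
  -- losses together stay within 1.002^k, and 1.002 · 12 / 4.1324 < 2.9098.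
  have h := sum_pow_mul_volume_ball_le (ι := Fin l.length) (fun i => (l.get i).center)
    (fun i => (l.get i).length / 4) 1 (t := Real.pi * 10 ^ 6) (R := 1 / 80000 * √k)
    (by positivity) ?_ (fun i => by have := (l.get i).length_nonneg; positivity)
    (fun i => by linarith [hshort _ (l.get_mem i)]) ?_
  · have hsum : ∑ i : Fin l.length, ((l.get i).length / 4) ^ k =
        (l.map fun e => (e.length / 4) ^ k).sum :=
      Fin.sum_univ_fun_getElem l fun e => (e.length / 4) ^ k
    have h12 : (l.map fun e => (3 * e.length) ^ k).sum =
        12 ^ k * (l.map fun e => (e.length / 4) ^ k).sum := by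
      rw [← List.sum_map_mul_left]
      refine congrArg List.sum (List.map_congr_left fun e _ => ?_)
      rw [← mul_pow]
      congr 1
      ring
    have h0 : 0 ≤ (l.map fun e => (3 * e.length) ^ k).sum := by
      refine List.sum_nonneg fun x hx => ?_
      obtain ⟨e, -, rfl⟩ := List.mem_map.1 hx
      have := e.length_nonneg
      positivity
    rw [hsum] at h
    generalize MeasureTheory.volume.real (Metric.ball (0 : EuclideanSpace ℝ (Fin k)) 1) = ω at *
    have hexp : Real.exp (Real.pi * 10 ^ 6 * (1 / 80000 * √k) ^ 2) ≤ (1.00099 : ℝ) ^ k := by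
      have h1 : Real.pi * 10 ^ 6 * (1 / 80000 * √k) ^ 2 ≤ k * 0.0005 := by
        rw [mul_pow, Real.sq_sqrt hk.le]
        nlinarith [Real.pi_lt_d4]
      have h2 : Real.exp 0.0005 ≤ 1.00099 := by
        have := Real.exp_bound' (x := 0.0005) (by norm_num) (by norm_num) (n := 2) (by norm_num)
        refine this.trans ?_
        norm_num [Finset.sum_range_succ, Nat.factorial]
      calc _ ≤ Real.exp (k * 0.0005) := Real.exp_le_exp.2 h1
        _ = Real.exp 0.0005 ^ k := Real.exp_nat_mul _ _
        _ ≤ _ := by gcongr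
    have hsqrt : 1 + √(Real.pi / (Real.pi * 10 ^ 6)) = 1.001 := by
      have : Real.pi / (Real.pi * 10 ^ 6) = (0.001 : ℝ) ^ 2 := by
        field_simp
        norm_num
      rw [this, Real.sqrt_sq (by norm_num)]
      norm_num
    rw [hsqrt] at h
    have h' : (l.map fun e => (e.length / 4) ^ k).sum * ω ≤ 1.002 ^ k := by
      calc _ ≤ _ := h
        _ ≤ ((1 : ℕ) : ℝ) * (1.00099 ^ k * 1.001 ^ k) := by gcongr
        _ ≤ 1.002 ^ k := by
          rw [← mul_pow, Nat.cast_one, one_mul]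
          gcongr
          norm_num
    calc (l.map fun e => (3 * e.length) ^ k).sum
        ≤ (l.map fun e => (3 * e.length) ^ k).sum * (C * k * (√k / 4.1324) ^ k * ω) :=
          le_mul_of_one_le_right h0 hball
      _ = ((l.map fun e => (e.length / 4) ^ k).sum * ω) * (C * k * (12 * (√k / 4.1324)) ^ k) := by
          rw [h12, mul_pow 12]
          ring
      _ ≤ 1.002 ^ k * (C * k * (12 * (√k / 4.1324)) ^ k) := by gcongr
      _ = C * k * (1.002 * (12 * (√k / 4.1324))) ^ k := by
          rw [mul_pow 1.002]
          ring
      _ ≤ _ := by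
          have : 1.002 * (12 * (√(k : ℝ) / 4.1324)) = 1.002 * 12 / 4.1324 * √k := by ring
          rw [this]
          gcongr
          norm_num
  · intro i
    have hmem : l.get i ∈ t.edges := Multiset.mem_toList.1 (hl.subset (l.get_mem i))
    generalize l.get i = e at hmem
    induction e with
    | _ a b =>
      exact midpoint_mem_unitCube (hcube _ (t.mem_verts_of_mem_edges hmem (by simp)))
        (hcube _ (t.mem_verts_of_mem_edges hmem (by simp)))
  · intro y s hs
    refine Finset.card_le_one.2 fun i hi j hj => ?_
    by_contra hij
    have h1 := hdisj i j hij
    have h2 := hs i hi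
    have h3 := hs j hj
    have h4 := dist_triangle_left (l.get i).center (l.get j).center y
    linarith

open Classical in
theorem List.sum_map_le_add_sum_countP {α : Type*} (l : List α) (φ g : α → ℝ) (p : α → Prop)
    (J : Finset ℕ) (q : ℕ → α → Prop) (c : ℕ → ℝ)
    (h : ∀ e ∈ l, φ e ≤ (if p e then g e else 0) + ∑ j ∈ J, if q j e then c j else 0) :
    (l.map φ).sum ≤ ((l.filter (p ·)).map g).sum + ∑ j ∈ J, (l.countP (q j ·) : ℝ) * c j := by
  induction l with
  | nil => simp
  | cons e l ih =>
    have h1 := h e (by simp)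
    have h2 := ih fun e he => h e (by simp [he])
    have h3 : (((e :: l).filter (p ·)).map g).sum =
        (if p e then g e else 0) + ((l.filter (p ·)).map g).sum := by
      by_cases hp : p e <;> simp [hp]
    have h4 : ∑ j ∈ J, ((e :: l).countP (q j ·) : ℝ) * c j =
        (∑ j ∈ J, if q j e then c j else 0) + ∑ j ∈ J, (l.countP (q j ·) : ℝ) * c j := by
      rw [← Finset.sum_add_distrib]
      refine Finset.sum_congr rfl fun j _ => ?_
      by_cases hq : q j e <;> (simp [hq]; try ring)
    rw [List.map_cons, List.sum_cons, h3, h4]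
    linarith

/-- Every `k`-th power capped at `√k ^ k` is covered by the short range or by one of the
finitely many geometric scales. -/
theorem exists_scales : ∃ N : ℕ, ∀ (k : ℕ) (x : ℝ), 0 ≤ x →
    min (3 * x) √k ^ k ≤ (if x ≤ 1 / 20000 * √k then (3 * x) ^ k else 0) +
      ∑ j ∈ Finset.range N, if 1 / 3 * (10 / 11 : ℝ) ^ j * √k ≤ x then
        (3.3 * (1 / 3 * (10 / 11 : ℝ) ^ j * √k)) ^ k else 0 := by
  -- This places scale `N` below the short range, since 3/20000 is three times 1/20000.
  obtain ⟨N, hN⟩ := exists_pow_lt_of_lt_one (show (0 : ℝ) < 3 / 20000 by norm_num)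
    (show (10 / 11 : ℝ) < 1 by norm_num)
  refine ⟨N + 1, fun k x hx => ?_⟩
  have hs := Real.sqrt_nonneg (k : ℝ)
  have hmin : 0 ≤ min (3 * x) √(k : ℝ) := le_min (by positivity) hs
  have hterm : ∀ j ∈ Finset.range (N + 1), 0 ≤ if 1 / 3 * (10 / 11 : ℝ) ^ j * √k ≤ x then
        (3.3 * (1 / 3 * (10 / 11 : ℝ) ^ j * √k)) ^ k else 0 := fun j _ => by
    split_ifs <;> positivity
  by_cases hshort : x ≤ 1 / 20000 * √k
  · rw [if_pos hshort]
    have h1 := Finset.sum_nonneg hterm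
    have h2 : min (3 * x) √(k : ℝ) ^ k ≤ (3 * x) ^ k := pow_le_pow_left₀ hmin (min_le_left _ _) k
    linarith
  · rw [if_neg hshort, zero_add]
    push Not at hshort
    have hex : ∃ j, 1 / 3 * (10 / 11 : ℝ) ^ j * √k ≤ x := by
      refine ⟨N, le_trans ?_ hshort.le⟩
      gcongr
      linarith
    classical
    have hj := Nat.find_spec hex
    have hjN : Nat.find hex ≤ N := Nat.find_min' hex (by
      refine le_trans ?_ hshort.le
      gcongr
      linarith)
    refine le_trans ?_ (Finset.single_le_sum hterm (Finset.mem_range.2 (Nat.lt_succ_of_le hjN)))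
    rw [if_pos hj]
    refine pow_le_pow_left₀ hmin ?_ k
    -- At the top scale the cap √k suffices. Otherwise `x` lies below the previous scale, which is
    -- 11/10 times the present one; hence the factor 3.3 = 3 · 11/10.
    rcases Nat.eq_zero_or_pos (Nat.find hex) with h0 | h0
    · rw [h0]
      refine (min_le_right _ _).trans ?_
      rw [pow_zero]
      linarith
    · have hlt := Nat.find_min hex (Nat.sub_lt h0 one_pos)
      push Not at hlt
      refine (min_le_left _ _).trans ?_
      obtain ⟨m, hm⟩ := Nat.exists_eq_succ_of_ne_zero h0.ne'
      rw [hm, Nat.succ_eq_add_one, Nat.add_sub_cancel] at hlt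
      rw [hm, pow_succ]
      linarith

/-! ### Assembling the bound -/

/-- The bound on the unscaled cost, with a factor that is linear in `k`. -/
theorem exists_tour_unscaledCost_le_mul_pow :
    ∃ C : ℝ, 0 < C ∧ ∀ k : ℕ, k ≠ 0 → ∀ X : Finset (EuclideanSpace ℝ (Fin k)), X.Nonempty →
      (X : Set (EuclideanSpace ℝ (Fin k))) ⊆ unitCube k →
      ∃ H : Tour X, H.unscaledCost ≤ C * k * (2.9098 * √k) ^ k := by
  obtain ⟨C, hC, hball⟩ := exists_one_le_mul_volume_ball
  obtain ⟨N, hN⟩ := exists_scales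
  -- The 2 counts the uses of each edge, the 1 stands for the short edges, and each of the `N`
  -- scales adds its overlap number 9.
  refine ⟨2 * (1 + 9 * N) * C, by positivity, fun k hk X hX hcube => ?_⟩
  have : NeZero k := ⟨hk⟩
  have hk' : (0 : ℝ) < k := by exact_mod_cast NeZero.pos k
  have hsk : 0 < √(k : ℝ) := Real.sqrt_pos.2 hk'
  obtain ⟨t, hv, ht⟩ := JoinTree.exists_isMinimal Sym2.length X.val
    (by simpa using hX.ne_empty)
  have hcube' : ∀ x ∈ t.verts, x ∈ unitCube k := fun x hx => hcube (by rw [hv] at hx; exact hx)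
  obtain ⟨H, hH⟩ := exists_tour_unscaledCost_le hk X hcube t hv
    (fun e => min (3 * e.length) √k ^ k) fun x y => rfl
  refine ⟨H, hH.trans ?_⟩
  classical
  have h1 := t.edges.toList.sum_map_le_add_sum_countP (fun e => min (3 * e.length) √k ^ k)
    (fun e => (3 * e.length) ^ k) (fun e => e.length ≤ 1 / 20000 * √k) (Finset.range N)
    (fun j e => 1 / 3 * (10 / 11 : ℝ) ^ j * √k ≤ e.length)
    (fun j => (3.3 * (1 / 3 * (10 / 11 : ℝ) ^ j * √k)) ^ k)
    (fun e _ => by convert hN k e.length e.length_nonneg)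
  have h2 := sum_short_pow_le hC (hball k hk) ht hcube'
    (t.edges.toList.filter fun e => e.length ≤ 1 / 20000 * √k) List.filter_sublist
    (fun e he => by simpa using (List.mem_filter.1 he).2)
  have h3 : ∀ j ∈ Finset.range N,
      (t.edges.toList.countP (fun e => 1 / 3 * (10 / 11 : ℝ) ^ j * √k ≤ e.length) : ℝ) *
        (3.3 * (1 / 3 * (10 / 11 : ℝ) ^ j * √k)) ^ k ≤ 9 * (C * k * (2.9098 * √k) ^ k) := by
    intro j _
    obtain ⟨S, hS, hSc, hSd⟩ := ht.exists_separated
      (l := 1 / 3 * (10 / 11 : ℝ) ^ j * √k) (by positivity)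
    have hle : t.edges.toList.countP (fun e => 1 / 3 * (10 / 11 : ℝ) ^ j * √k ≤ e.length) ≤
        S.card := by
      rw [hSc, ← Multiset.coe_countP, Multiset.coe_toList]
      refine le_of_eq_of_le ?_ (Nat.le_succ _)
      congr
    have h := card_mul_pow_le_of_separated hC (hball k hk) S (fun x hx => hcube' x (hS x hx))
      (x := 1 / 3 * (10 / 11 : ℝ) ^ j) (by positivity)
      (mul_le_of_le_one_right (by norm_num) (pow_le_one₀ (by norm_num) (by norm_num))) hSd
    calc _ ≤ (S.card : ℝ) * (3.3 * (1 / 3 * (10 / 11 : ℝ) ^ j * √k)) ^ k := by gcongr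
      _ ≤ _ := h
      _ ≤ _ := by
        gcongr
        norm_num
  have h4 := Finset.sum_le_sum h3
  rw [Finset.sum_const, Finset.card_range, nsmul_eq_mul] at h4
  have h5 : (t.edges.map fun e => min (3 * e.length) √k ^ k).sum =
      (t.edges.toList.map fun e => min (3 * e.length) √k ^ k).sum := by
    conv_lhs => rw [← Multiset.coe_toList t.edges]
    rw [Multiset.map_coe, Multiset.sum_coe]
  rw [h5]
  have h6 : (t.edges.toList.map fun e => min (3 * e.length) √k ^ k).sum ≤
      C * k * (2.9098 * √k) ^ k + N * (9 * (C * k * (2.9098 * √k) ^ k)) := by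
    refine h1.trans (add_le_add ?_ ?_)
    · convert h2
    · convert h4
  calc _ ≤ 2 * (C * k * (2.9098 * √k) ^ k + N * (9 * (C * k * (2.9098 * √k) ^ k))) := by gcongr
    _ = _ := by ring

theorem eventually_mul_pow_le (C : ℝ) :
    ∀ᶠ k : ℕ in atTop, C * k * (2.9098 * √k) ^ k ≤ (2.91 * √(k : ℝ)) ^ k := by
  have h := tendsto_self_mul_const_pow_of_lt_one (r := 2.9098 / 2.91) (by norm_num) (by norm_num)
  have h' := (h.const_mul C).eventually (Iic_mem_nhds (show C * 0 < 1 by simp))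
  filter_upwards [h'] with k hk
  have hk' : C * (k * (2.9098 / 2.91) ^ k) ≤ 1 := hk
  calc C * k * (2.9098 * √k) ^ k = C * (k * (2.9098 / 2.91) ^ k) * (2.91 * √(k : ℝ)) ^ k := by
        rw [← mul_assoc C, mul_assoc (C * (k : ℝ)), ← mul_pow]
        congr 2
        ring
    _ ≤ 1 * (2.91 * √(k : ℝ)) ^ k := by gcongr
    _ = _ := one_mul _

theorem theorem5 :
    ∃ ε : ℕ → ℝ, ε =o[atTop] (fun _ => (1 : ℝ)) ∧
      ∀ᶠ k : ℕ in atTop, sHC k ≤ ENNReal.ofReal (2.91 * √(k : ℝ) * (1 + ε k)) := by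
  obtain ⟨C, -, hC⟩ := exists_tour_unscaledCost_le_mul_pow
  -- No error term is needed: the gap between 2.9098 and 2.91 absorbs the linear factor for large
  -- `k`.
  refine ⟨fun _ => 0, isLittleO_zero _ _, ?_⟩
  filter_upwards [eventually_mul_pow_le C, eventually_ne_atTop 0] with k hk hk0
  refine iSup₂_le fun n hn => iSup_le fun X => iSup₂_le fun hX hcard => ?_
  refine ENNReal.ofReal_le_ofReal ?_
  obtain ⟨H, hH⟩ := hC k hk0 X (Finset.card_pos.1 (by omega)) hX
  have hH0 : 0 ≤ H.unscaledCost := Finset.sum_nonneg fun i _ => pow_nonneg dist_nonneg k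
  calc sHCSet X ≤ H.scaledCost := (isLeast_sHCSet X).2 ⟨H, rfl⟩
    _ ≤ ((2.91 * √(k : ℝ)) ^ k) ^ (1 / (k : ℝ)) :=
        Real.rpow_le_rpow hH0 (hH.trans hk) (by positivity)
    _ = 2.91 * √(k : ℝ) * (1 + 0) := by
        rw [one_div, Real.pow_rpow_inv_natCast (by positivity) hk0, add_zero, mul_one]
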